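/- On $\mathbb R^3$ let $\kappa_2(x,y)=|x-y|^{-1}$ be the Newtonian kernel ($n=3$, $\alpha=2$), with value $+\infty$ for $x=y$. For a kernel $\kappa\ge 0$ and a positive measure $\mu$ write $U_\kappa^\mu(x)=\int\kappa(x,y)\,d\mu(y)$ for its potential and $E_\kappa(\mu)=\int\kappa\,d(\mu\otimes\mu)$ for its energy. The (inner) Newtonian capacity of a set $Q\subset\mathbb R^3$ is $c_2(Q)=\bigl[\inf E_{\kappa_2}(\mu)\bigr]^{-1}$, the infimum being over the positive measures of total mass $1$ carried by $Q$; a property holds nearly everywhere (n.e.) on a set if it holds there outside a subset of capacity zero. For an open set $D\subset\mathbb R^3$ whose complement $D^c$ has positive capacity, the Green kernel of $D$ is $$g_D(x,y)=U_{\kappa_2}^{\varepsilon_y}(x)-U_{\kappa_2}^{\varepsilon_y'}(x),\qquad x,y\in D,$$ where $\varepsilon_y$ is the unit mass at $y$ and $\varepsilon_y'$ is its balayage onto $D^c$, i.e. the positive Radon measure carried by $D^c$ that charges no compact set of capacity zero and satisfies $U_{\kappa_2}^{\varepsilon_y'}=U_{\kappa_2}^{\varepsilon_y}$ n.e. on $D^c$.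 (i) Let $D=\{x\in\mathbb R^3:\ x_1>0\}$. There is a positive Radon measure $\mu$ on $D$ with $\mu(D)=1$, $E_{g_D}(\mu)\le 1$ and $E_{\kappa_2}(\mu)=\infty$. (ii) Let $D^*$ be the open ball in $\mathbb R^3$ with centre $(1,0,0)$ and radius $1$. There is a bounded positive Radon measure $\mu^*$ on $D^*$ with $E_{g_{D^*}}(\mu^*)\le 1$ and $E_{\kappa_2}(\mu^*)=\infty$. Here the Newtonian energies are those of the extensions of $\mu$ and $\mu^*$ by zero to $\mathbb R^3$. In particular, finiteness of the Green energy of a bounded positive measure on $D$ or on $D^*$ does not imply finiteness of its Newtonian energy. -/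

import Mathlib

open MeasureTheory
open scoped ENNReal

namespace RieszGreen

/-- The energy `∫ κ(x,y) d(μ ⊗ μ)(x,y)` of a positive measure `μ` relative to a kernel `κ`. -/
noncomputable def energy {X : Type*} [MeasurableSpace X] (κ : X → X → ℝ≥0∞) (μ : Measure X) :
    ℝ≥0∞ :=
  ∫⁻ p, κ p.1 p.2 ∂(μ.prod μ)

/-- The potential `x ↦ ∫ κ(x,y) dμ(y)` of a positive measure `μ` relative to a kernel `κ`. -/
noncomputable def potential {X : Type*} [MeasurableSpace X] (κ : X → X → ℝ≥0∞) (μ : Measure X)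
    (x : X) : ℝ≥0∞ :=
  ∫⁻ y, κ x y ∂μ

/-- The `α`-Riesz kernel `|x - y|^(α - n)` on `ℝⁿ`; for `α < n` it equals `∞` on the diagonal. -/
noncomputable def rieszKernel {n : ℕ} (α : ℝ) (x y : EuclideanSpace ℝ (Fin n)) : ℝ≥0∞ :=
  edist x y ^ (α - (n : ℝ))

/-- The (inner) `α`-Riesz capacity of an arbitrary set `Q ⊆ ℝⁿ`: the reciprocal of the infimum of
the energy over all positive measures of total mass one carried by `Q`
(with `1 / 0 = ∞` and `1 / ∞ = 0`). -/
noncomputable def rieszCapacity {n : ℕ} (α : ℝ) (Q : Set (EuclideanSpace ℝ (Fin n))) : ℝ≥0∞ :=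
  (⨅ μ ∈ {μ : Measure (EuclideanSpace ℝ (Fin n)) | μ Qᶜ = 0 ∧ μ Q = 1},
    energy (rieszKernel α) μ)⁻¹

/-- `P` holds nearly everywhere on `Q`: the exceptional set has zero `α`-Riesz capacity. -/
def NearlyEverywhereOn {n : ℕ} (α : ℝ) (Q : Set (EuclideanSpace ℝ (Fin n)))
    (P : EuclideanSpace ℝ (Fin n) → Prop) : Prop :=
  rieszCapacity α {x | x ∈ Q ∧ ¬ P x} = 0

/-- `β` is the `α`-Riesz balayage of `ν` onto the closed set `A`: a positive Radon measure carried
by `A`, charging no compact set of zero capacity, whose potential agrees with that of `ν` nearly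
everywhere on `A`. -/
structure IsBalayage {n : ℕ} (α : ℝ) (A : Set (EuclideanSpace ℝ (Fin n)))
    (ν β : Measure (EuclideanSpace ℝ (Fin n))) : Prop where
  locallyFinite : IsLocallyFiniteMeasure β
  carried : β Aᶜ = 0
  absolutelyContinuous : ∀ K, IsCompact K → rieszCapacity α K = 0 → β K = 0
  potential_eq : NearlyEverywhereOn α A
    fun x => potential (rieszKernel α) β x = potential (rieszKernel α) ν x

open Classical in
/-- The `α`-Riesz balayage of `ν` onto `A` (the zero measure if there is none). -/
noncomputable def balayage {n : ℕ} (α : ℝ) (A : Set (EuclideanSpace ℝ (Fin n)))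
    (ν : Measure (EuclideanSpace ℝ (Fin n))) : Measure (EuclideanSpace ℝ (Fin n)) :=
  if h : ∃ β, IsBalayage α A ν β then h.choose else 0

/-- The `α`-Green kernel on `D`: the Riesz potential of the unit mass at `y` minus the Riesz
potential of its balayage onto the complement of `D`. -/
noncomputable def greenKernel {n : ℕ} (α : ℝ) (D : Set (EuclideanSpace ℝ (Fin n))) (x y : D) :
    ℝ≥0∞ :=
  potential (rieszKernel α) (Measure.dirac (y : EuclideanSpace ℝ (Fin n))) x
    - potential (rieszKernel α)
        (balayage α Dᶜ (Measure.dirac (y : EuclideanSpace ℝ (Fin n)))) x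

/-- The extension by zero to `ℝⁿ` of a measure on `D`. -/
noncomputable def extend {n : ℕ} {D : Set (EuclideanSpace ℝ (Fin n))} (μ : Measure D) :
    Measure (EuclideanSpace ℝ (Fin n)) :=
  μ.map Subtype.val

/-- The open half-space `x₁ > 0` in `ℝ³`. -/
def halfSpace : Set (EuclideanSpace ℝ (Fin 3)) := {x | 0 < x 0}

/-- The open ball in `ℝ³` with centre `(1, 0, 0)` and radius `1`. -/
def unitBall : Set (EuclideanSpace ℝ (Fin 3)) := Metric.ball !₂[1, 0, 0] 1

end RieszGreen

namespace RieszGreen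

/-! The Green kernel decays at the boundary of the domain, the Newtonian kernel does not. Spread
mass `b i = 2^-(i+1)` over a surface patch of width `R = b i ^ 2 / 4`. Its Newtonian energy is of
order `(b i)² / R`, hence bounded below uniformly in `i`, and the sum over `i` diverges. With the
width fixed, the patch can be moved so close to the boundary that its normalized mass has Green
potential at most 1; since the masses sum to 1, the total Green energy is at most 1
(`exists_measure_of_patches`).

The Green kernel is controlled by the method of images. If `D = {k |a - x| < |a - x'|}`, then
`g(x,y) = 1/|x-y| - k/|y-x'|` off the diagonal (`greenKernel_eq`), whence `g(x,y) ≤ |x-x'|^(1/2)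
|x-y|^(-3/2)` (`greenKernel_le`). The power 3/2 is integrable over surfaces, and the first factor
tends to 0 at the boundary.

The image formula rests on an explicit balayage: the Kelvin transform of a uniform sphere measure,
whose potential comes from Newton's shell theorem (`exists_measure_apollonius`). As `balayage` is an
arbitrary choice, reciprocity with this finite-energy measure is used to evaluate the potential of
every balayage (`IsBalayage.potential_eq_of_isImagePoint`), so no uniqueness theorem is needed. -/

/-! ### Spherical coordinates and zonal integrals. -/

theorem lintegral_radial_prod (G : ℝ → ℝ≥0∞) (hG : Measurable G) :
    ∫⁻ p : ℝ × ℝ, G (√(p.1 ^ 2 + p.2 ^ 2)) =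
      ENNReal.ofReal (2 * Real.pi) * ∫⁻ ρ : ℝ, ENNReal.ofReal ρ * G ρ := by
  rw [← lintegral_comp_polarCoord_symm]
  have h1 : ∀ p ∈ polarCoord.target, ENNReal.ofReal p.1 •
      G (√((polarCoord.symm p).1 ^ 2 + (polarCoord.symm p).2 ^ 2)) =
      (ENNReal.ofReal p.1 * G p.1) * 1 := by
    intro p hp
    have hp1 : 0 < p.1 := hp.1
    have : √((polarCoord.symm p).1 ^ 2 + (polarCoord.symm p).2 ^ 2) = p.1 := by
      rw [polarCoord_symm_apply]
      rw [show (p.1 * Real.cos p.2) ^ 2 + (p.1 * Real.sin p.2) ^ 2 = p.1 ^ 2 by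
        nlinarith [Real.sin_sq_add_cos_sq p.2]]
      exact Real.sqrt_sq hp1.le
    rw [this]; simp
  rw [setLIntegral_congr_fun polarCoord.open_target.measurableSet h1, polarCoord_target,
    Measure.volume_eq_prod, ← Measure.prod_restrict,
    lintegral_prod_mul (f := fun r => ENNReal.ofReal r * G r) (g := fun _ => 1)
      (by fun_prop) (by fun_prop)]
  rw [mul_comm]
  congr 1
  · simp [two_mul, ENNReal.ofReal_add, Real.pi_nonneg]
  · rw [← lintegral_indicator measurableSet_Ioi]
    refine lintegral_congr fun r => ?_
    by_cases hr : 0 < r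
    · simp [hr]
    · simp [hr, ENNReal.ofReal_of_nonpos (not_lt.1 hr)]

/-- Substitution `c = cos θ` on `(0, π)`; on the other half of the angular range `ENNReal.ofReal`
truncates the negative sine to 0. -/
theorem lintegral_sin_mul_comp_cos (h : ℝ → ℝ≥0∞) :
    ∫⁻ θ in Set.Ioo (-Real.pi) Real.pi, ENNReal.ofReal (Real.sin θ) * h (Real.cos θ) =
      ∫⁻ c in Set.Icc (-1 : ℝ) 1, h c := by
  have him : Real.cos '' Set.Icc 0 Real.pi = Set.Icc (-1 : ℝ) 1 := Real.bijOn_cos.image_eq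
  rw [← him, lintegral_image_eq_lintegral_abs_deriv_mul measurableSet_Icc
    (fun x _ => (Real.hasDerivAt_cos x).hasDerivWithinAt) Real.injOn_cos]
  rw [← setLIntegral_congr (Ioo_ae_eq_Icc (a := (0 : ℝ)) (b := Real.pi)),
    ← lintegral_indicator measurableSet_Ioo, ← lintegral_indicator measurableSet_Ioo]
  refine lintegral_congr fun θ => ?_
  have hpi := Real.pi_pos
  by_cases h1 : θ ∈ Set.Ioo 0 Real.pi
  · have h2 : θ ∈ Set.Ioo (-Real.pi) Real.pi := ⟨by linarith [h1.1], h1.2⟩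
    have h3 := Real.sin_pos_of_mem_Ioo h1
    simp [h1, h2, abs_of_pos h3]
  · by_cases h2 : θ ∈ Set.Ioo (-Real.pi) Real.pi
    · have h3 : θ ≤ 0 := by
        by_contra h4
        exact h1 ⟨not_le.1 h4, h2.2⟩
      have := Real.sin_nonpos_of_nonpos_of_neg_pi_le h3 h2.1.le
      simp [h1, h2, ENNReal.ofReal_of_nonpos this]
    · simp [h1, h2]

/-- Archimedes: the axial coordinate of a uniform point of the sphere is uniform on `[-1, 1]`. Polar
coordinates are used twice, in the last two variables and then in the plane of height and axial
distance. -/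
theorem exists_lintegral_prod_eq_const_mul (W : ℝ → ℝ≥0∞) (hW : Measurable W) :
    ∃ C : ℝ≥0∞, ∀ h : ℝ → ℝ≥0∞, Measurable h →
      ∫⁻ x : ℝ × (ℝ × ℝ), W (√(x.1 ^ 2 + (x.2.1 ^ 2 + x.2.2 ^ 2))) *
        h (x.1 / √(x.1 ^ 2 + (x.2.1 ^ 2 + x.2.2 ^ 2))) = C * ∫⁻ c in Set.Icc (-1 : ℝ) 1, h c := by
  refine ⟨ENNReal.ofReal (2 * Real.pi) * ∫⁻ r in Set.Ioi (0 : ℝ), ENNReal.ofReal (r ^ 2) * W r,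
    fun h hh => ?_⟩
  rw [Measure.volume_eq_prod, lintegral_prod _ (by fun_prop)]
  have h1 : ∀ z : ℝ, ∫⁻ y : ℝ × ℝ, W (√(z ^ 2 + (y.1 ^ 2 + y.2 ^ 2))) *
        h (z / √(z ^ 2 + (y.1 ^ 2 + y.2 ^ 2))) = ENNReal.ofReal (2 * Real.pi) *
        ∫⁻ ρ : ℝ, ENNReal.ofReal ρ * (W (√(z ^ 2 + ρ ^ 2)) * h (z / √(z ^ 2 + ρ ^ 2))) := by
    intro z
    rw [← lintegral_radial_prod (fun ρ => W (√(z ^ 2 + ρ ^ 2)) * h (z / √(z ^ 2 + ρ ^ 2)))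
      (by fun_prop)]
    refine lintegral_congr fun y => ?_
    rw [Real.sq_sqrt (by positivity)]
  simp_rw [h1]
  rw [lintegral_const_mul _ (by fun_prop), mul_assoc]
  congr 1
  rw [← lintegral_prod (fun p : ℝ × ℝ => ENNReal.ofReal p.2 *
    (W (√(p.1 ^ 2 + p.2 ^ 2)) * h (p.1 / √(p.1 ^ 2 + p.2 ^ 2)))) (by fun_prop),
    ← Measure.volume_eq_prod, ← lintegral_comp_polarCoord_symm]
  have h2 : ∀ p ∈ polarCoord.target, ENNReal.ofReal p.1 •
      (ENNReal.ofReal (polarCoord.symm p).2 *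
      (W (√((polarCoord.symm p).1 ^ 2 + (polarCoord.symm p).2 ^ 2)) *
        h ((polarCoord.symm p).1 / √((polarCoord.symm p).1 ^ 2 + (polarCoord.symm p).2 ^ 2)))) =
      (ENNReal.ofReal (p.1 ^ 2) * W p.1) * (ENNReal.ofReal (Real.sin p.2) * h (Real.cos p.2)) := by
    intro p hp
    have hp1 : 0 < p.1 := hp.1
    have : √((polarCoord.symm p).1 ^ 2 + (polarCoord.symm p).2 ^ 2) = p.1 := by
      rw [polarCoord_symm_apply]
      rw [show (p.1 * Real.cos p.2) ^ 2 + (p.1 * Real.sin p.2) ^ 2 = p.1 ^ 2 by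
        nlinarith [Real.sin_sq_add_cos_sq p.2]]
      exact Real.sqrt_sq hp1.le
    rw [this, polarCoord_symm_apply, mul_div_cancel_left₀ _ hp1.ne', pow_two,
      ENNReal.ofReal_mul hp1.le, ENNReal.ofReal_mul hp1.le, smul_eq_mul]
    ring
  rw [setLIntegral_congr_fun polarCoord.open_target.measurableSet h2, polarCoord_target,
    Measure.volume_eq_prod, ← Measure.prod_restrict,
    lintegral_prod_mul (f := fun r => ENNReal.ofReal (r ^ 2) * W r)
      (g := fun θ => ENNReal.ofReal (Real.sin θ) * h (Real.cos θ))
      (by fun_prop) (by fun_prop), lintegral_sin_mul_comp_cos]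

/-- The integrand has antiderivative `-√(1 + r² - 2rc) / r`, with end values given by `|1 - r|` and
`1 + r`. For `r = 1` it is singular at `c = 1`, so derivatives are taken on the open interval only.
-/
theorem lintegral_inv_sqrt (r : ℝ) (hr : 0 < r) :
    ∫⁻ c in Set.Icc (-1 : ℝ) 1, (ENNReal.ofReal √(1 + r ^ 2 - 2 * r * c))⁻¹ =
      ENNReal.ofReal (2 * min 1 r⁻¹) := by
  set g : ℝ → ℝ := fun c => - (√(1 + r ^ 2 - 2 * r * c) / r) with hg
  have hpos : ∀ c ∈ Set.Ioo (-1 : ℝ) 1, 0 < 1 + r ^ 2 - 2 * r * c := by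
    intro c hc
    nlinarith [sq_nonneg (1 - r), mul_pos hr (sub_pos.2 hc.2)]
  have hcont : ContinuousOn g (Set.Icc (-1) 1) := by
    apply Continuous.continuousOn; fun_prop
  have hder : ∀ c ∈ Set.Ioo (-1 : ℝ) 1, HasDerivAt g (√(1 + r ^ 2 - 2 * r * c))⁻¹ c := by
    intro c hc
    have h1 : HasDerivAt (fun c : ℝ => 1 + r ^ 2 - 2 * r * c) (-(2 * r)) c := by
      simpa using! ((hasDerivAt_id c).const_mul (2 * r)).const_sub (1 + r ^ 2)
    convert! ((h1.sqrt (hpos c hc).ne').div_const r).neg using 1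
    have := Real.sqrt_pos.2 (hpos c hc)
    field_simp
  have hnn : ∀ c, 0 ≤ (√(1 + r ^ 2 - 2 * r * c))⁻¹ := fun c => by positivity
  have hint : IntegrableOn (fun c : ℝ => (√(1 + r ^ 2 - 2 * r * c))⁻¹) (Set.Ioc (-1) 1) :=
    intervalIntegral.integrableOn_deriv_of_nonneg hcont hder (fun c _ => hnn c)
  have hinv : ∀ c ∈ Set.Ioo (-1 : ℝ) 1, (ENNReal.ofReal √(1 + r ^ 2 - 2 * r * c))⁻¹ =
      ENNReal.ofReal (√(1 + r ^ 2 - 2 * r * c))⁻¹ := fun c hc =>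
    (ENNReal.ofReal_inv_of_pos (Real.sqrt_pos.2 (hpos c hc))).symm
  rw [← setLIntegral_congr (Ioo_ae_eq_Icc (a := (-1 : ℝ)) (b := 1)),
    setLIntegral_congr_fun measurableSet_Ioo hinv,
    setLIntegral_congr (Ioo_ae_eq_Ioc (a := (-1 : ℝ)) (b := 1)),
    ← ofReal_integral_eq_lintegral_ofReal hint (Filter.Eventually.of_forall hnn),
    ← intervalIntegral.integral_of_le (by norm_num),
    intervalIntegral.integral_eq_sub_of_hasDerivAt_of_le (by norm_num) hcont hder
      ((intervalIntegrable_iff_integrableOn_Ioc_of_le (by norm_num)).2 hint)]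
  congr 1
  have e1 : √(1 + r ^ 2 - 2 * r * 1) = |1 - r| := by
    rw [← Real.sqrt_sq_eq_abs]; congr 1; ring
  have e2 : √(1 + r ^ 2 - 2 * r * (-1)) = 1 + r := by
    rw [← Real.sqrt_sq (by positivity : 0 ≤ 1 + r)]; congr 1; ring
  simp only [hg, e1, e2]
  rcases le_total r 1 with h | h
  · rw [abs_of_nonneg (by linarith), min_eq_left (by rw [le_inv_comm₀ one_pos hr]; simpa using h)]
    field_simp; ring
  · rw [abs_of_nonpos (by linarith), min_eq_right (by rw [inv_le_comm₀ hr one_pos]; simpa using h)]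
    field_simp; ring

theorem measurePreserving_coords :
    MeasurePreserving (fun x : EuclideanSpace ℝ (Fin 3) => (x 0, (x 1, x 2))) volume volume := by
  have h1 := EuclideanSpace.volume_preserving_symm_measurableEquiv_toLp (Fin 3)
  have h2 := volume_preserving_piFinSuccAbove (fun _ : Fin 3 => ℝ) 0
  have h3 := (MeasurePreserving.id (volume : Measure ℝ)).prod (volume_preserving_finTwoArrow ℝ)
  exact h3.comp (h2.comp h1)

theorem exists_lintegral_eq_const_mul (W : ℝ → ℝ≥0∞) (hW : Measurable W) :
    ∃ C : ℝ≥0∞, ∀ h : ℝ → ℝ≥0∞, Measurable h →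
      ∫⁻ x : EuclideanSpace ℝ (Fin 3), W ‖x‖ * h (x 0 / ‖x‖) =
        C * ∫⁻ c in Set.Icc (-1 : ℝ) 1, h c := by
  obtain ⟨C, hC⟩ := exists_lintegral_prod_eq_const_mul W hW
  refine ⟨C, fun h hh => ?_⟩
  rw [← hC h hh, ← measurePreserving_coords.lintegral_comp (by fun_prop)]
  refine lintegral_congr fun x => ?_
  simp [EuclideanSpace.norm_eq, Fin.sum_univ_three, add_assoc]

/-! ### The uniform measure on the unit sphere and Newton's shell theorem. -/

theorem exists_linearIsometryEquiv_apply_eq {F : Type*} [NormedAddCommGroup F]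
    [InnerProductSpace ℝ F] {v w : F} (h : ‖v‖ = ‖w‖) : ∃ L : F ≃ₗᵢ[ℝ] F, L v = w :=
  ⟨_, Submodule.reflection_sub h⟩

theorem norm_single_sub_normalize (r : ℝ) (x : EuclideanSpace ℝ (Fin 3)) (hx : x ≠ 0) :
    ‖EuclideanSpace.single 0 r - ‖x‖⁻¹ • x‖ = √(1 + r ^ 2 - 2 * r * (x 0 / ‖x‖)) := by
  have hn : ‖x‖ ≠ 0 := norm_ne_zero_iff.2 hx
  rw [← Real.sqrt_sq (norm_nonneg _), norm_sub_sq_real, norm_smul, inner_smul_right,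
    EuclideanSpace.inner_single_left]
  congr 1
  simp [hn]
  ring

/-- The uniform probability measure on the unit sphere, obtained by projecting the normalized
Lebesgue measure of the unit ball. -/
noncomputable def sphereMeasure : Measure (EuclideanSpace ℝ (Fin 3)) :=
  (volume (Metric.ball (0 : EuclideanSpace ℝ (Fin 3)) 1))⁻¹ •
    (volume.restrict (Metric.ball 0 1)).map fun x => ‖x‖⁻¹ • x

theorem lintegral_sphereMeasure {f : EuclideanSpace ℝ (Fin 3) → ℝ≥0∞} (hf : Measurable f) :
    ∫⁻ w, f w ∂sphereMeasure = (volume (Metric.ball (0 : EuclideanSpace ℝ (Fin 3)) 1))⁻¹ *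
      ∫⁻ x in Metric.ball 0 1, f (‖x‖⁻¹ • x) := by
  rw [sphereMeasure, lintegral_smul_measure, lintegral_map hf (by fun_prop), smul_eq_mul]

theorem volume_ball_ne_zero : volume (Metric.ball (0 : EuclideanSpace ℝ (Fin 3)) 1) ≠ 0 :=
  (Metric.measure_ball_pos _ _ one_pos).ne'

theorem volume_ball_ne_top : volume (Metric.ball (0 : EuclideanSpace ℝ (Fin 3)) 1) ≠ ⊤ :=
  measure_ball_lt_top.ne

instance : IsProbabilityMeasure sphereMeasure := ⟨by
  rw [← lintegral_one, lintegral_sphereMeasure measurable_const]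
  simpa using ENNReal.inv_mul_cancel volume_ball_ne_zero volume_ball_ne_top⟩

theorem ae_sphereMeasure : ∀ᵐ w ∂sphereMeasure, ‖w‖ = 1 := by
  refine Measure.ae_smul_measure ?_ _
  rw [ae_map_iff (by fun_prop) (measurableSet_eq_fun (by fun_prop) (by fun_prop))]
  filter_upwards [ae_restrict_of_ae (Measure.ae_ne volume 0)] with x hx
  rw [norm_smul, norm_inv, norm_norm, inv_mul_cancel₀ (norm_ne_zero_iff.2 hx)]

theorem lintegral_ball_comp_linearIsometryEquiv
    (L : EuclideanSpace ℝ (Fin 3) ≃ₗᵢ[ℝ] EuclideanSpace ℝ (Fin 3))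
    {f : EuclideanSpace ℝ (Fin 3) → ℝ≥0∞} (hf : Measurable f) :
    ∫⁻ x in Metric.ball 0 1, f (L x) = ∫⁻ x in Metric.ball 0 1, f x := by
  have h := L.measurePreserving.setLIntegral_comp_preimage
    (measurableSet_ball (x := (0 : EuclideanSpace ℝ (Fin 3))) (ε := 1)) hf
  rw [← h]
  congr 2
  ext x
  simp

/-- Newton's shell theorem: the potential of the uniform measure on the unit sphere. -/
theorem lintegral_inv_edist_sphereMeasure (a : EuclideanSpace ℝ (Fin 3)) :
    ∫⁻ w, (edist a w)⁻¹ ∂sphereMeasure = min 1 (edist a 0)⁻¹ := by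
  rcases eq_or_ne a 0 with rfl | ha
  · have : ∀ᵐ w ∂sphereMeasure, (edist 0 w)⁻¹ = 1 := by
      filter_upwards [ae_sphereMeasure] with w hw
      rw [edist_comm, edist_zero_right, ← ofReal_norm, hw]; simp
    rw [lintegral_congr_ae this]; simp
  set r := ‖a‖ with hr
  have hr0 : 0 < r := norm_pos_iff.2 ha
  obtain ⟨L, hL⟩ := exists_linearIsometryEquiv_apply_eq
    (v := a) (w := EuclideanSpace.single (0 : Fin 3) r) (by simp [hr])
  set W : ℝ → ℝ≥0∞ := (Set.Iio 1).indicator 1 with hW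
  have hWm : Measurable W := measurable_one.indicator measurableSet_Iio
  obtain ⟨C, hC⟩ := exists_lintegral_eq_const_mul W hWm
  have hball : ∀ f : EuclideanSpace ℝ (Fin 3) → ℝ≥0∞,
      ∫⁻ x in Metric.ball 0 1, f x = ∫⁻ x, W ‖x‖ * f x := by
    intro f
    rw [← lintegral_indicator measurableSet_ball]
    refine lintegral_congr fun x => ?_
    by_cases hx : ‖x‖ < 1
    · rw [Set.indicator_of_mem (by simpa using hx)]; simp [W, hx]
    · rw [Set.indicator_of_notMem (by simpa using hx)]; simp [W, hx]
  -- Testing with `h = 1` determines `C`, which then cancels against the normalization.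
  have hvol : volume (Metric.ball (0 : EuclideanSpace ℝ (Fin 3)) 1) = C * 2 := by
    have h1 := hC (fun _ => 1) measurable_const
    rw [← hball] at h1
    simp only [lintegral_one, Measure.restrict_apply_univ, Real.volume_Icc] at h1
    rw [h1]; norm_num
  have hmain : ∫⁻ x in Metric.ball 0 1, (edist a (‖x‖⁻¹ • x))⁻¹ =
      C * ENNReal.ofReal (2 * min 1 r⁻¹) := by
    rw [← lintegral_inv_sqrt r hr0, ← hC _ (by fun_prop), ← hball,
      ← lintegral_ball_comp_linearIsometryEquiv L
        (f := fun x => (ENNReal.ofReal √(1 + r ^ 2 - 2 * r * (x 0 / ‖x‖)))⁻¹) (by fun_prop)]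
    refine lintegral_congr_ae ?_
    filter_upwards [ae_restrict_of_ae (Measure.ae_ne volume 0)] with x hx
    have hLx : L x ≠ 0 := by simpa using hx
    rw [← norm_single_sub_normalize r (L x) hLx, L.norm_map, ← hL, ← map_smul, ← map_sub,
      L.norm_map, edist_dist, dist_eq_norm]
  rw [lintegral_sphereMeasure (by fun_prop), hmain, hvol, ENNReal.ofReal_mul zero_le_two,
    ENNReal.ofReal_ofNat, ← mul_assoc, ← mul_assoc, mul_assoc _ C 2, ENNReal.inv_mul_cancel (hvol ▸ volume_ball_ne_zero)
      (hvol ▸ volume_ball_ne_top), one_mul, edist_zero_right, ← ofReal_norm, ← hr,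
      ← ENNReal.ofReal_inv_of_pos hr0, ← ENNReal.ofReal_one]
  exact ENNReal.ofReal_min _ _

/-! ### Spheres of any radius and their Kelvin transforms. -/

theorem rieszKernel_two (x y : EuclideanSpace ℝ (Fin 3)) : rieszKernel 2 x y = (edist x y)⁻¹ := by
  rw [rieszKernel, show (2 : ℝ) - ((3 : ℕ) : ℝ) = -1 by norm_num, ENNReal.rpow_neg_one]

theorem measurable_rieszKernel :
    Measurable fun p : EuclideanSpace ℝ (Fin 3) × EuclideanSpace ℝ (Fin 3) =>
      rieszKernel 2 p.1 p.2 := by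
  simp_rw [rieszKernel_two]; fun_prop

theorem potential_two (μ : Measure (EuclideanSpace ℝ (Fin 3))) (a : EuclideanSpace ℝ (Fin 3)) :
    potential (rieszKernel 2) μ a = ∫⁻ z, (edist a z)⁻¹ ∂μ := by
  simp_rw [potential, rieszKernel_two]

/-- The uniform measure on an arbitrary sphere, together with its potential. -/
theorem exists_measure_sphere (c : EuclideanSpace ℝ (Fin 3)) {R : ℝ} (hR : 0 < R) :
    ∃ σ : Measure (EuclideanSpace ℝ (Fin 3)), IsProbabilityMeasure σ ∧
      (∀ᵐ w ∂σ, dist w c = R) ∧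
      ∀ a, ∫⁻ w, (edist a w)⁻¹ ∂σ = min (ENNReal.ofReal R)⁻¹ (edist a c)⁻¹ := by
  have hm : Measurable fun w : EuclideanSpace ℝ (Fin 3) => c + R • w := by fun_prop
  refine ⟨sphereMeasure.map fun w => c + R • w, Measure.isProbabilityMeasure_map hm.aemeasurable,
    ?_, fun a => ?_⟩
  · rw [ae_map_iff hm.aemeasurable (measurableSet_eq_fun (by fun_prop) (by fun_prop))]
    filter_upwards [ae_sphereMeasure] with w hw
    rw [dist_eq_norm, add_sub_cancel_left, norm_smul, hw, Real.norm_of_nonneg hR.le, mul_one]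
  · rw [lintegral_map (by fun_prop) hm]
    have hR0 : ENNReal.ofReal R ≠ 0 := by simpa using hR
    have key : ∀ w, edist a (c + R • w) = ENNReal.ofReal R * edist (R⁻¹ • (a - c)) w := by
      intro w
      rw [edist_dist, edist_dist, ← ENNReal.ofReal_mul hR.le, dist_eq_norm, dist_eq_norm]
      congr 1
      nth_rewrite 2 [← Real.norm_of_nonneg hR.le]
      rw [← norm_smul, smul_sub, smul_inv_smul₀ hR.ne']
      congr 1; abel
    have h0 := key 0
    simp only [smul_zero, add_zero] at h0
    simp_rw [key]
    simp_rw [ENNReal.mul_inv (Or.inl hR0) (Or.inl ENNReal.ofReal_ne_top)]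
    rw [lintegral_const_mul _ (by fun_prop), lintegral_inv_edist_sphereMeasure, h0,
      ENNReal.mul_inv (Or.inl hR0) (Or.inl ENNReal.ofReal_ne_top)]
    rw [mul_min, mul_one]

theorem ae_ne_of_lintegral_inv_edist_ne_top {X : Type*} [PseudoEMetricSpace X] [MeasurableSpace X]
    [OpensMeasurableSpace X] {σ : Measure X} {y : X} (h : ∫⁻ w, (edist y w)⁻¹ ∂σ ≠ ⊤) :
    ∀ᵐ w ∂σ, w ≠ y := by
  filter_upwards [ae_lt_top (by fun_prop) h] with w hw hwy
  simp [hwy] at hw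

open EuclideanGeometry in
/-- The Kelvin transform of the uniform measure on a sphere: a probability measure on the
Apollonius sphere `|z - y'| = k |z - y|` whose potential is explicit. -/
theorem exists_measure_apollonius {y y' : EuclideanSpace ℝ (Fin 3)} (hy : y ≠ y') {k : ℝ}
    (hk : 1 ≤ k) :
    ∃ β : Measure (EuclideanSpace ℝ (Fin 3)), IsProbabilityMeasure β ∧
      (∀ᵐ z ∂β, dist z y' = k * dist z y) ∧
      ∀ a, a ≠ y → potential (rieszKernel 2) β a =
        min (edist a y)⁻¹ (ENNReal.ofReal k * (edist a y')⁻¹) := by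
  have hd : 0 < dist y' y := dist_pos.2 hy.symm
  set c := inversion y 1 y' with hc
  have hcy : c ≠ y := by rw [hc, Ne, inversion_eq_center one_ne_zero]; exact hy.symm
  have hcd : dist c y = 1 / dist y' y := by rw [hc, dist_inversion_center]; simp
  -- Inversion at `y` sends the sphere of centre `c` and radius `R` (minus `y`) into the set `|z -
  -- y'| = k |z - y|`.
  set R := k / dist y' y with hRdef
  have hk0 : 0 < k := by linarith
  have hR : 0 < R := by positivity
  obtain ⟨σ, hσ, hσc, hσp⟩ := exists_measure_sphere c hR
  -- This is where `1 ≤ k` enters: `y` is not outside the sphere, so the potential of `σ` there is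
  -- `1 / R`, and the Kelvin density `R / |y - w|` has total mass 1.
  have hyR : dist c y ≤ R := by rw [hcd, hRdef]; gcongr
  have hofR : ENNReal.ofReal R ≠ 0 := by simpa using hR
  have hσy : ∫⁻ w, (edist y w)⁻¹ ∂σ = (ENNReal.ofReal R)⁻¹ := by
    rw [hσp, min_eq_left]
    rw [ENNReal.inv_le_inv, edist_comm, edist_dist]
    exact ENNReal.ofReal_le_ofReal hyR
  have hne : ∀ᵐ w ∂σ, w ≠ y :=
    ae_ne_of_lintegral_inv_edist_ne_top (by rw [hσy]; simpa using hR)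
  have hIm : Measurable (inversion y (1 : ℝ) : EuclideanSpace ℝ (Fin 3) → _) := by
    unfold inversion
    simp only [vsub_eq_sub, vadd_eq_add]
    fun_prop
  set ρ : EuclideanSpace ℝ (Fin 3) → ℝ≥0∞ := fun w => ENNReal.ofReal R * (edist y w)⁻¹ with hρ
  have hρm : Measurable ρ := by fun_prop
  refine ⟨(σ.withDensity ρ).map (inversion y 1), ⟨?_⟩, ?_, fun a ha => ?_⟩
  · rw [Measure.map_apply hIm MeasurableSet.univ, Set.preimage_univ,
      withDensity_apply _ MeasurableSet.univ, Measure.restrict_univ,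
      lintegral_const_mul _ (by fun_prop), hσy,
      ENNReal.mul_inv_cancel hofR ENNReal.ofReal_ne_top]
  · rw [ae_map_iff hIm.aemeasurable (measurableSet_eq_fun (by fun_prop) (by fun_prop))]
    refine (withDensity_absolutelyContinuous σ ρ).ae_le ?_
    filter_upwards [hσc, hne] with w hw hwy
    have h1 : y' = inversion y 1 c := by rw [hc, inversion_inversion _ one_ne_zero]
    rw [h1, dist_inversion_inversion hwy hcy, hw, hcd, dist_inversion_center, hRdef]
    have hdw : 0 < dist w y := dist_pos.2 hwy
    field_simp
  · rw [potential_two, lintegral_map (by fun_prop) hIm,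
      lintegral_withDensity_eq_lintegral_mul _ hρm (by fun_prop)]
    have hIa : inversion y 1 a ≠ y := by rwa [Ne, inversion_eq_center one_ne_zero]
    have hda : 0 < dist a y := dist_pos.2 ha
    -- From `|a - Iw| |y - w| = |a - y| |Ia - w|`: the transformed potential at `a` is a multiple of
    -- that of `σ` at `Ia`.
    have key : ∀ᵐ w ∂σ, (ρ * fun w => (edist a (inversion y 1 w))⁻¹) w =
        (ENNReal.ofReal R * (edist a y)⁻¹) * (edist (inversion y 1 a) w)⁻¹ := by
      filter_upwards [hne] with w hwy
      have hdw : 0 < dist w y := dist_pos.2 hwy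
      have h1 : edist a (inversion y 1 w) * edist y w = edist a y * edist (inversion y 1 a) w := by
        rw [edist_dist, edist_dist, edist_dist, edist_dist, ← ENNReal.ofReal_mul dist_nonneg,
          ← ENNReal.ofReal_mul dist_nonneg]
        congr 1
        nth_rewrite 1 [← inversion_inversion y one_ne_zero a]
        rw [dist_inversion_inversion hIa hwy, dist_inversion_center, dist_comm y w]
        field_simp
      simp only [Pi.mul_apply, hρ]
      rw [mul_assoc, mul_assoc]
      congr 1
      rw [mul_comm, ← ENNReal.mul_inv (Or.inr (edist_ne_top _ _))
        (Or.inr (by rw [edist_comm]; simpa using hwy)), h1,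
        ENNReal.mul_inv (Or.inl (by simpa using ha)) (Or.inl (edist_ne_top _ _))]
    rw [lintegral_congr_ae key, lintegral_const_mul _ (by fun_prop), hσp, mul_min]
    congr 1
    · rw [mul_comm, ← mul_assoc, ENNReal.inv_mul_cancel hofR ENNReal.ofReal_ne_top, one_mul]
    · have h1 : edist (inversion y 1 a) c * edist a y =
          edist a y' * ENNReal.ofReal (dist y' y)⁻¹ := by
        rw [edist_dist, edist_dist, edist_dist, ← ENNReal.ofReal_mul dist_nonneg,
          ← ENNReal.ofReal_mul dist_nonneg]
        congr 1
        rw [hc, dist_inversion_inversion ha hy.symm]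
        field_simp
      have hay : edist a y ≠ 0 := by simpa using ha
      rw [mul_assoc, ← ENNReal.mul_inv (Or.inl hay) (Or.inl (edist_ne_top _ _)), mul_comm (edist a y),
        h1, ENNReal.mul_inv (Or.inr ENNReal.ofReal_ne_top) (Or.inr (by simpa using hd)),
        ← ENNReal.ofReal_inv_of_pos (inv_pos.2 hd), inv_inv, mul_comm (edist a y')⁻¹, ← mul_assoc,
        ← ENNReal.ofReal_mul hR.le, hRdef, div_mul_cancel₀ _ hd.ne']

/-! ### Image points, capacity and balayage. -/

/-- `y'` is an image point of `y` relative to `D`: `D` is the Apollonius domain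
`k |a - y| < |a - y'|`. -/
structure IsImagePoint (D : Set (EuclideanSpace ℝ (Fin 3))) (y y' : EuclideanSpace ℝ (Fin 3))
    (k : ℝ) : Prop where
  ne : y ≠ y'
  one_le : 1 ≤ k
  mem_iff : ∀ a, a ∈ D ↔ k * dist a y < dist a y'

theorem energy_eq_lintegral_potential (μ : Measure (EuclideanSpace ℝ (Fin 3))) [SFinite μ] :
    energy (rieszKernel 2) μ = ∫⁻ x, potential (rieszKernel 2) μ x ∂μ :=
  lintegral_prod _ measurable_rieszKernel.aemeasurable

theorem measurable_potential (μ : Measure (EuclideanSpace ℝ (Fin 3))) [SFinite μ] :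
    Measurable (potential (rieszKernel 2) μ) :=
  measurable_rieszKernel.lintegral_prod_right'

theorem potential_dirac (x y : EuclideanSpace ℝ (Fin 3)) :
    potential (rieszKernel 2) (Measure.dirac y) x = (edist x y)⁻¹ := by
  rw [potential_two, lintegral_dirac]

theorem lintegral_potential_comm (μ ν : Measure (EuclideanSpace ℝ (Fin 3))) [SFinite μ]
    [SFinite ν] : ∫⁻ x, potential (rieszKernel 2) μ x ∂ν =
      ∫⁻ x, potential (rieszKernel 2) ν x ∂μ := by
  simp_rw [potential_two]
  rw [lintegral_lintegral_swap (by fun_prop)]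
  simp_rw [edist_comm]

theorem rieszCapacity_empty {n : ℕ} (α : ℝ) :
    rieszCapacity α (∅ : Set (EuclideanSpace ℝ (Fin n))) = 0 := by
  simp [rieszCapacity]

/-- A finite measure of finite energy does not charge measurable sets of capacity zero. -/
theorem measure_eq_zero_of_rieszCapacity_eq_zero {n : ℕ} {α : ℝ}
    {ρ : Measure (EuclideanSpace ℝ (Fin n))} [IsFiniteMeasure ρ]
    (hρ : energy (rieszKernel α) ρ ≠ ⊤) {N : Set (EuclideanSpace ℝ (Fin n))}
    (hN : MeasurableSet N) (hcap : rieszCapacity α N = 0) : ρ N = 0 := by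
  by_contra h0
  have htop : ρ N ≠ ⊤ := measure_ne_top ρ N
  rw [rieszCapacity, ENNReal.inv_eq_zero] at hcap
  have hinv : (ρ N)⁻¹ ≠ ⊤ := by simpa using h0
  have h1 : energy (rieszKernel α) ((ρ N)⁻¹ • ρ.restrict N) = ⊤ := by
    refine iInf₂_eq_top.1 hcap _ ⟨?_, ?_⟩
    · simp [Measure.restrict_apply hN.compl]
    · simp [ENNReal.inv_mul_cancel h0 htop]
  have h2 : energy (rieszKernel α) ((ρ N)⁻¹ • ρ.restrict N) ≤
      (ρ N)⁻¹ * ((ρ N)⁻¹ * energy (rieszKernel α) ρ) := by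
    unfold energy
    rw [Measure.prod_smul_left, Measure.prod_smul_right, Measure.prod_restrict,
      lintegral_smul_measure, lintegral_smul_measure, smul_eq_mul, smul_eq_mul]
    gcongr
    exact Measure.restrict_le_self
  rw [h1, top_le_iff] at h2
  exact ENNReal.mul_ne_top hinv (ENNReal.mul_ne_top hinv hρ) h2

theorem IsImagePoint.inv_edist_le {D : Set (EuclideanSpace ℝ (Fin 3))}
    {y y' : EuclideanSpace ℝ (Fin 3)} {k : ℝ} (h : IsImagePoint D y y' k)
    {a : EuclideanSpace ℝ (Fin 3)} (ha : a ∉ D) :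
    (edist a y)⁻¹ ≤ ENNReal.ofReal k * (edist a y')⁻¹ := by
  rw [h.mem_iff, not_lt] at ha
  have hk : 0 < k := by linarith [h.one_le]
  have hk0 : ENNReal.ofReal k ≠ 0 := by simpa using hk
  have h1 : edist a y' ≤ ENNReal.ofReal k * edist a y := by
    rw [edist_dist, edist_dist, ← ENNReal.ofReal_mul hk.le]
    exact ENNReal.ofReal_le_ofReal ha
  calc (edist a y)⁻¹ = ENNReal.ofReal k * (ENNReal.ofReal k * edist a y)⁻¹ := by
        rw [ENNReal.mul_inv (Or.inl hk0) (Or.inl ENNReal.ofReal_ne_top), ← mul_assoc,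
          ENNReal.mul_inv_cancel hk0 ENNReal.ofReal_ne_top, one_mul]
    _ ≤ _ := by gcongr

theorem IsImagePoint.inv_edist_ge {D : Set (EuclideanSpace ℝ (Fin 3))}
    {y y' : EuclideanSpace ℝ (Fin 3)} {k : ℝ} (h : IsImagePoint D y y' k)
    {a : EuclideanSpace ℝ (Fin 3)} (ha : a ∈ D) :
    ENNReal.ofReal k * (edist a y')⁻¹ ≤ (edist a y)⁻¹ := by
  rw [h.mem_iff] at ha
  have hk : 0 < k := by linarith [h.one_le]
  have hk0 : ENNReal.ofReal k ≠ 0 := by simpa using hk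
  have h1 : ENNReal.ofReal k * edist a y ≤ edist a y' := by
    rw [edist_dist, edist_dist, ← ENNReal.ofReal_mul hk.le]
    exact ENNReal.ofReal_le_ofReal ha.le
  calc ENNReal.ofReal k * (edist a y')⁻¹ ≤
        ENNReal.ofReal k * (ENNReal.ofReal k * edist a y)⁻¹ := by gcongr
    _ = _ := by
        rw [ENNReal.mul_inv (Or.inl hk0) (Or.inl ENNReal.ofReal_ne_top), ← mul_assoc,
          ENNReal.mul_inv_cancel hk0 ENNReal.ofReal_ne_top, one_mul]

theorem IsImagePoint.mem {D : Set (EuclideanSpace ℝ (Fin 3))}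
    {y y' : EuclideanSpace ℝ (Fin 3)} {k : ℝ} (h : IsImagePoint D y y' k) : y ∈ D := by
  rw [h.mem_iff, dist_self, mul_zero]
  exact dist_pos.2 h.ne

/-- The explicit balayage of the unit mass at a point admitting an image point. -/
theorem IsImagePoint.exists_isBalayage {D : Set (EuclideanSpace ℝ (Fin 3))}
    {y y' : EuclideanSpace ℝ (Fin 3)} {k : ℝ} (h : IsImagePoint D y y' k) :
    ∃ β : Measure (EuclideanSpace ℝ (Fin 3)), IsFiniteMeasure β ∧
      IsBalayage 2 Dᶜ (Measure.dirac y) β ∧ energy (rieszKernel 2) β ≠ ⊤ ∧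
      (∀ a, a ∉ D → potential (rieszKernel 2) β a = (edist a y)⁻¹) ∧
      ∀ a, a ∈ D → a ≠ y →
        potential (rieszKernel 2) β a = ENNReal.ofReal k * (edist a y')⁻¹ := by
  obtain ⟨β, hβ, hcar, hpot⟩ := exists_measure_apollonius h.ne h.one_le
  have hout : ∀ a, a ∉ D → potential (rieszKernel 2) β a = (edist a y)⁻¹ := by
    intro a ha
    rw [hpot a (by rintro rfl; exact ha h.mem), min_eq_left (h.inv_edist_le ha)]
  have hD : ∀ᵐ z ∂β, z ∉ D := by
    filter_upwards [hcar] with z hz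
    rw [h.mem_iff, hz]; exact lt_irrefl _
  have hd : 0 < dist y y' := dist_pos.2 h.ne
  have hk := h.one_le
  have hen : energy (rieszKernel 2) β ≠ ⊤ := by
    rw [energy_eq_lintegral_potential]
    -- On the carrier the potential is `1 / |z - y|`, and `|y - y'| ≤ |z - y| + |z - y'| = (k + 1)
    -- |z - y|`.
    have hle : ∫⁻ x, potential (rieszKernel 2) β x ∂β ≤
        ∫⁻ _, (ENNReal.ofReal (dist y y' / (k + 1)))⁻¹ ∂β := by
      refine lintegral_mono_ae ?_
      filter_upwards [hD, hcar] with z hz hz'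
      rw [hout z hz, ENNReal.inv_le_inv, edist_dist]
      refine ENNReal.ofReal_le_ofReal ?_
      rw [div_le_iff₀ (by linarith)]
      have := dist_triangle_left y y' z
      linarith
    refine ne_top_of_le_ne_top ?_ hle
    rw [lintegral_const]
    refine ENNReal.mul_ne_top ?_ (measure_ne_top _ _)
    simp only [ne_eq, ENNReal.inv_eq_top, ENNReal.ofReal_eq_zero, not_le]
    positivity
  refine ⟨β, inferInstance, ⟨inferInstance, ?_, ?_, ?_⟩, hen, hout, ?_⟩
  · rw [compl_compl]
    simpa using measure_eq_zero_iff_ae_notMem.2 hD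
  · exact fun K hK hcap => measure_eq_zero_of_rieszCapacity_eq_zero hen hK.measurableSet hcap
  · unfold NearlyEverywhereOn
    convert! rieszCapacity_empty (n := 3) 2
    ext a
    simp only [Set.mem_compl_iff, Set.mem_ofPred_eq, Set.mem_empty_iff_false, iff_false, not_and,
      not_not]
    intro ha
    rw [hout a ha, potential_dirac]
  · intro a ha hay
    rw [hpot a hay, min_eq_right (h.inv_edist_ge ha)]

/-- Every balayage of the unit mass at `y` has the expected potential at points of `D` admitting
an image point. -/
theorem IsBalayage.potential_eq_of_isImagePoint {D : Set (EuclideanSpace ℝ (Fin 3))}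
    (hDm : MeasurableSet D) {x x' y : EuclideanSpace ℝ (Fin 3)} {k : ℝ}
    (hx : IsImagePoint D x x' k) (hy : y ∈ D) (hxy : x ≠ y)
    {B : Measure (EuclideanSpace ℝ (Fin 3))} (hB : IsBalayage 2 Dᶜ (Measure.dirac y) B) :
    potential (rieszKernel 2) B x = ENNReal.ofReal k * (edist y x')⁻¹ := by
  obtain ⟨β, hβ, hbal, hen, hout, hin⟩ := hx.exists_isBalayage
  have := hB.locallyFinite
  have hBD : ∀ᵐ z ∂B, z ∉ D := by
    rw [← measure_eq_zero_iff_ae_notMem]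
    simpa using hB.carried
  have hβD : ∀ᵐ z ∂β, z ∉ D := by
    rw [← measure_eq_zero_iff_ae_notMem]
    simpa using hbal.carried
  -- The exceptional set of `B` has capacity zero, so the finite-energy measure `β` ignores it.
  -- Reciprocity then moves the evaluation from `B` at `x` to `β` at `y`.
  have hN : β {z | z ∈ Dᶜ ∧ ¬ potential (rieszKernel 2) B z =
      potential (rieszKernel 2) (Measure.dirac y) z} = 0 := by
    refine measure_eq_zero_of_rieszCapacity_eq_zero hen ?_ hB.potential_eq
    exact hDm.compl.inter
      (measurableSet_eq_fun (measurable_potential _) (measurable_potential _)).compl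
  calc potential (rieszKernel 2) B x = ∫⁻ z, (edist x z)⁻¹ ∂B := potential_two _ _
    _ = ∫⁻ z, potential (rieszKernel 2) β z ∂B := by
        refine lintegral_congr_ae ?_
        filter_upwards [hBD] with z hz
        rw [hout z hz, edist_comm]
    _ = ∫⁻ z, potential (rieszKernel 2) B z ∂β := lintegral_potential_comm _ _
    _ = ∫⁻ z, (edist y z)⁻¹ ∂β := by
        refine lintegral_congr_ae ?_
        filter_upwards [hβD, measure_eq_zero_iff_ae_notMem.1 hN] with z hz hz'
        have := not_not.1 fun h => hz' ⟨hz, h⟩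
        rw [this, potential_dirac, edist_comm]
    _ = potential (rieszKernel 2) β y := (potential_two _ _).symm
    _ = _ := hin y hy hxy.symm

/-! ### The Green kernel: image formula and upper bound. -/

/-- The image of `y` only guarantees that a balayage exists; the value at `x` comes from reciprocity
and therefore involves the image of `x`. -/
theorem greenKernel_eq {D : Set (EuclideanSpace ℝ (Fin 3))} (hDm : MeasurableSet D)
    {x y : D} {x' y' : EuclideanSpace ℝ (Fin 3)} {k l : ℝ} (hx : IsImagePoint D x x' k)
    (hy : IsImagePoint D y y' l) (hxy : x ≠ y) :
    greenKernel 2 D x y = (edist (x : EuclideanSpace ℝ (Fin 3)) y)⁻¹ -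
      ENNReal.ofReal k * (edist (y : EuclideanSpace ℝ (Fin 3)) x')⁻¹ := by
  have hex : ∃ β, IsBalayage 2 Dᶜ (Measure.dirac (y : EuclideanSpace ℝ (Fin 3))) β := by
    obtain ⟨β, -, h, -⟩ := hy.exists_isBalayage
    exact ⟨β, h⟩
  have hbal : IsBalayage 2 Dᶜ (Measure.dirac (y : EuclideanSpace ℝ (Fin 3)))
      (balayage 2 Dᶜ (Measure.dirac (y : EuclideanSpace ℝ (Fin 3)))) := by
    rw [balayage, dif_pos hex]
    exact hex.choose_spec
  rw [greenKernel, potential_dirac,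
    hbal.potential_eq_of_isImagePoint hDm hx y.2 fun h => hxy (Subtype.ext h)]

/-- The difference is at most `1/a` and at most `d/a²`; the right side is the geometric mean of
these two bounds. -/
theorem one_div_sub_one_div_le {a b d : ℝ} (ha : 0 < a) (hab : a ≤ b) (hb : b ≤ a + d)
    (hd : 0 < d) : 1 / a - 1 / b ≤ d ^ (1 / 2 : ℝ) * a ^ (-(3 / 2) : ℝ) := by
  have hb0 : 0 < b := by linarith
  rcases le_total a d with h | h
  · calc 1 / a - 1 / b ≤ 1 / a := by linarith [one_div_pos.2 hb0]
      _ = a ^ (1 / 2 : ℝ) * a ^ (-(3 / 2) : ℝ) := by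
          rw [← Real.rpow_add ha]; norm_num [Real.rpow_neg_one]
      _ ≤ _ := by gcongr
  · calc 1 / a - 1 / b = (b - a) / (a * b) := by field_simp
      _ ≤ d / (a * a) := by gcongr; linarith
      _ = d ^ (1 / 2 : ℝ) * d ^ (1 / 2 : ℝ) * a ^ (-2 : ℝ) := by
          rw [← Real.rpow_add hd, Real.rpow_neg ha.le]
          norm_num
          field_simp
      _ ≤ d ^ (1 / 2 : ℝ) * a ^ (1 / 2 : ℝ) * a ^ (-2 : ℝ) := by gcongr
      _ = _ := by
          rw [mul_assoc, ← Real.rpow_add ha]; norm_num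

theorem greenKernel_le {D : Set (EuclideanSpace ℝ (Fin 3))} (hDm : MeasurableSet D)
    {x y : D} {x' y' : EuclideanSpace ℝ (Fin 3)} {k l : ℝ} (hx : IsImagePoint D x x' k)
    (hy : IsImagePoint D y y' l) :
    greenKernel 2 D x y ≤ edist (x : EuclideanSpace ℝ (Fin 3)) x' ^ (1 / 2 : ℝ) *
      edist (x : EuclideanSpace ℝ (Fin 3)) y ^ (-(3 / 2) : ℝ) := by
  have hd : 0 < dist (x : EuclideanSpace ℝ (Fin 3)) x' := dist_pos.2 hx.ne
  rcases eq_or_ne x y with rfl | hxy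
  · rw [edist_self, ENNReal.zero_rpow_of_neg (by norm_num), ENNReal.mul_top]
    · exact le_top
    · rw [edist_dist, ENNReal.ofReal_rpow_of_pos hd]
      simp only [ne_eq, ENNReal.ofReal_eq_zero, not_le]
      positivity
  have ha : 0 < dist (x : EuclideanSpace ℝ (Fin 3)) y :=
    dist_pos.2 fun h => hxy (Subtype.ext h)
  have hk := hx.one_le
  have hyD := (hx.mem_iff y).1 y.2
  rw [dist_comm (y : EuclideanSpace ℝ (Fin 3)) x] at hyD
  have hb : 0 < dist (y : EuclideanSpace ℝ (Fin 3)) x' := lt_of_le_of_lt (by positivity) hyD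
  have htri := dist_triangle_left (y : EuclideanSpace ℝ (Fin 3)) x' x
  rw [greenKernel_eq hDm hx hy hxy]
  simp only [edist_dist]
  rw [ENNReal.ofReal_rpow_of_pos hd, ENNReal.ofReal_rpow_of_pos ha,
    ← ENNReal.ofReal_mul (by positivity), ← ENNReal.ofReal_inv_of_pos ha,
    ← ENNReal.ofReal_inv_of_pos hb, ← ENNReal.ofReal_mul (by positivity),
    ← ENNReal.ofReal_sub _ (by positivity)]
  refine ENNReal.ofReal_le_ofReal ?_
  refine le_trans ?_ (one_div_sub_one_div_le ha ?_ htri hd)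
  · rw [one_div, one_div]
    have : (dist (y : EuclideanSpace ℝ (Fin 3)) x')⁻¹ ≤
      k * (dist (y : EuclideanSpace ℝ (Fin 3)) x')⁻¹ := le_mul_of_one_le_left (by positivity) hk
    linarith
  · nlinarith

/-! ### Uniform potential bounds for surface patches. -/

theorem rpow_neg_anti {a b : ℝ≥0∞} {z : ℝ} (hz : 0 ≤ z) (h : a ≤ b) : b ^ (-z) ≤ a ^ (-z) := by
  rw [ENNReal.rpow_neg, ENNReal.rpow_neg, ENNReal.inv_le_inv]
  exact ENNReal.rpow_le_rpow h hz

theorem lintegral_indicator_edist_rpow_lt_top {z : ℝ} (hz : z < 1) :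
    ∫⁻ u : ℝ, (Set.Icc (-1) 1).indicator (fun u => edist u 0 ^ (-z)) u < ⊤ := by
  have h1 : Integrable (fun u : ℝ => (Set.Iic (1 : ℝ)).indicator (fun r => r ^ (-z)) ‖u‖) := by
    rw [integrable_fun_norm_addHaar volume]
    simp only [Module.finrank_self, tsub_self, pow_zero, one_smul]
    rw [← Set.Ioc_union_Ioi_eq_Ioi zero_le_one, integrableOn_union]
    constructor
    · have h2 := (intervalIntegral.intervalIntegrable_rpow' (a := 0) (b := 1) (r := -z)
        (by linarith))
      rw [intervalIntegrable_iff_integrableOn_Ioc_of_le zero_le_one] at h2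
      exact h2.congr_fun (fun x hx => by simp [hx.2]) measurableSet_Ioc
    · exact integrableOn_zero.congr_fun
        (fun x hx => by simp [not_le.2 (Set.mem_Ioi.1 hx)]) measurableSet_Ioi
  have h3 := h1.hasFiniteIntegral
  rw [HasFiniteIntegral] at h3
  refine lt_of_eq_of_lt (lintegral_congr_ae ?_) h3
  filter_upwards [Measure.ae_ne volume 0] with u hu
  have hu' : 0 < |u| := abs_pos.2 hu
  by_cases h : |u| ≤ 1
  · rw [Set.indicator_of_mem (Set.mem_Icc.2 (abs_le.1 h)), Set.indicator_of_mem (by simpa using h), edist_dist,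
      ENNReal.ofReal_rpow_of_pos (by simpa using hu), Real.enorm_eq_ofReal (by positivity)]
    simp
  · rw [Set.indicator_of_notMem (fun h' => h (abs_le.2 (Set.mem_Icc.1 h'))),
      Set.indicator_of_notMem (by simpa using h), enorm_zero]

/-- After scaling, the kernel is at most 1 plus its truncation to `[-1, 1]`, whose integral is
translation invariant; hence `C` does not depend on `c`. -/
theorem exists_lintegral_edist_rpow_le {z : ℝ} (hz0 : 0 ≤ z) (hz : z < 1) {R : ℝ} (hR : 0 < R) :
    ∃ C : ℝ, 0 < C ∧ ∀ c : ℝ, ∫⁻ s in Set.Icc (0 : ℝ) 1, edist (R * s) c ^ (-z) ≤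
      ENNReal.ofReal C := by
  set G : ℝ → ℝ≥0∞ := (Set.Icc (-1) 1).indicator (fun u => edist u 0 ^ (-z)) with hG
  have hGm : Measurable G := Measurable.indicator (by fun_prop) measurableSet_Icc
  have hfin := lintegral_indicator_edist_rpow_lt_top hz
  set K : ℝ≥0∞ := ENNReal.ofReal R ^ (-z) * (1 + ∫⁻ u, G u) with hK
  have hKtop : K ≠ ⊤ := by
    refine ENNReal.mul_ne_top ?_ (ENNReal.add_ne_top.2 ⟨ENNReal.one_ne_top, hfin.ne⟩)
    rw [ENNReal.ofReal_rpow_of_pos hR]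
    exact ENNReal.ofReal_ne_top
  refine ⟨K.toReal + 1, by positivity, fun c => ?_⟩
  refine le_trans ?_ ((ENNReal.ofReal_toReal hKtop).symm.le.trans
    (ENNReal.ofReal_le_ofReal (by linarith)))
  have h1 : ∀ s : ℝ, edist (R * s) c ^ (-z) ≤ ENNReal.ofReal R ^ (-z) * (1 + G (s - c / R)) := by
    intro s
    have h2 : edist (R * s) c = ENNReal.ofReal R * edist (s - c / R) 0 := by
      rw [edist_dist, edist_dist, ← ENNReal.ofReal_mul hR.le, Real.dist_eq, Real.dist_eq, sub_zero]
      congr 1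
      nth_rewrite 2 [← abs_of_pos hR]
      rw [← abs_mul, mul_sub, mul_div_cancel₀ _ hR.ne']
    rw [h2, ENNReal.mul_rpow_of_ne_top ENNReal.ofReal_ne_top (edist_ne_top _ _)]
    gcongr
    by_cases h : s - c / R ∈ Set.Icc (-1 : ℝ) 1
    · rw [hG, Set.indicator_of_mem h]
      exact le_add_self
    · refine le_trans ?_ le_self_add
      have h3 : 1 ≤ edist (s - c / R) 0 := by
        rw [edist_dist, Real.dist_eq, sub_zero, ← ENNReal.ofReal_one]
        refine ENNReal.ofReal_le_ofReal ?_
        by_contra h4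
        exact h (abs_le.1 (not_le.1 h4).le)
      simpa using rpow_neg_anti hz0 h3
  calc ∫⁻ s in Set.Icc (0 : ℝ) 1, edist (R * s) c ^ (-z)
      ≤ ∫⁻ s in Set.Icc (0 : ℝ) 1, ENNReal.ofReal R ^ (-z) * (1 + G (s - c / R)) :=
        lintegral_mono h1
    _ = ENNReal.ofReal R ^ (-z) * (1 + ∫⁻ s in Set.Icc (0 : ℝ) 1, G (s - c / R)) := by
        rw [lintegral_const_mul _ (by fun_prop), lintegral_add_left measurable_const]
        simp
    _ ≤ K := by
        rw [hK, ← lintegral_sub_right_eq_self G (c / R)]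
        gcongr
        exact Measure.restrict_le_self

/-- The point `(φ(s,t), R s, R t)` with parameters `q = (s,t)`. -/
noncomputable def patch (φ : ℝ × ℝ → ℝ) (R : ℝ) (q : ℝ × ℝ) : EuclideanSpace ℝ (Fin 3) :=
  !₂[φ q, R * q.1, R * q.2]

theorem measurable_patch {φ : ℝ × ℝ → ℝ} (hφ : Measurable φ) (R : ℝ) :
    Measurable (patch φ R) := by
  refine (WithLp.measurable_toLp 2 (Fin 3 → ℝ)).comp (measurable_pi_iff.2 fun i => ?_)
  fin_cases i
  · exact hφ
  · exact measurable_fst.const_mul R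
  · exact measurable_snd.const_mul R

/-- The uniform measure on the parameter square. -/
noncomputable def squareMeasure : Measure (ℝ × ℝ) :=
  volume.restrict (Set.Icc 0 1 ×ˢ Set.Icc 0 1)

theorem squareMeasure_eq_prod : squareMeasure =
    (volume.restrict (Set.Icc (0 : ℝ) 1)).prod (volume.restrict (Set.Icc (0 : ℝ) 1)) := by
  rw [squareMeasure, Measure.volume_eq_prod, Measure.prod_restrict]

instance : IsProbabilityMeasure squareMeasure := by
  have : IsProbabilityMeasure (volume.restrict (Set.Icc (0 : ℝ) 1)) := ⟨by simp⟩
  rw [squareMeasure_eq_prod]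
  infer_instance

theorem ae_squareMeasure : ∀ᵐ q ∂squareMeasure, q ∈ Set.Icc (0 : ℝ) 1 ×ˢ Set.Icc (0 : ℝ) 1 :=
  ae_restrict_mem (measurableSet_Icc.prod measurableSet_Icc)

/-- Splitting 3/2 as 3/4 + 3/4 reduces to two one-dimensional integrals with exponent below 1,
whatever the height `φ`. -/
theorem edist_patch_rpow_le (φ : ℝ × ℝ → ℝ) (R : ℝ) (q : ℝ × ℝ) (y : EuclideanSpace ℝ (Fin 3)) :
    edist (patch φ R q) y ^ (-(3 / 2) : ℝ) ≤
      edist (R * q.1) (y 1) ^ (-(3 / 4) : ℝ) * edist (R * q.2) (y 2) ^ (-(3 / 4) : ℝ) := by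
  have h1 : edist (R * q.1) (y 1) ≤ edist (patch φ R q) y :=
    PiLp.edist_apply_le (patch φ R q) y 1
  have h2 : edist (R * q.2) (y 2) ≤ edist (patch φ R q) y :=
    PiLp.edist_apply_le (patch φ R q) y 2
  have h3 : edist (patch φ R q) y ^ (-(3 / 2) : ℝ) =
      edist (patch φ R q) y ^ (-(3 / 4) : ℝ) * edist (patch φ R q) y ^ (-(3 / 4) : ℝ) := by
    rw [← pow_two, ← ENNReal.rpow_natCast, ← ENNReal.rpow_mul]; norm_num
  rw [h3]
  exact mul_le_mul' (rpow_neg_anti (by norm_num) h1) (rpow_neg_anti (by norm_num) h2)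

/-- The potential of a patch measure relative to `|x - y|^(-3/2)` is bounded. -/
theorem exists_lintegral_edist_patch_rpow_le {R : ℝ} (hR : 0 < R) :
    ∃ C : ℝ, 0 < C ∧ ∀ (φ : ℝ × ℝ → ℝ) (y : EuclideanSpace ℝ (Fin 3)),
      ∫⁻ q, edist (patch φ R q) y ^ (-(3 / 2) : ℝ) ∂squareMeasure ≤ ENNReal.ofReal C := by
  obtain ⟨C, hC, hCle⟩ := exists_lintegral_edist_rpow_le (z := 3 / 4) (by norm_num) (by norm_num) hR
  refine ⟨C * C, by positivity, fun φ y => (lintegral_mono fun q =>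
    edist_patch_rpow_le φ R q y).trans ?_⟩
  rw [squareMeasure_eq_prod, lintegral_prod_mul (f := fun s => edist (R * s) (y 1) ^ (-(3 / 4) : ℝ))
    (g := fun s => edist (R * s) (y 2) ^ (-(3 / 4) : ℝ)) (by fun_prop) (by fun_prop),
    ENNReal.ofReal_mul hC.le]
  gcongr
  · exact hCle _
  · exact hCle _

theorem edist_patch_le {φ : ℝ × ℝ → ℝ} {R : ℝ} (hR : 0 < R) {q q' : ℝ × ℝ}
    (hq : q ∈ Set.Icc (0 : ℝ) 1 ×ˢ Set.Icc (0 : ℝ) 1)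
    (hq' : q' ∈ Set.Icc (0 : ℝ) 1 ×ˢ Set.Icc (0 : ℝ) 1)
    (hφ : |φ q| ≤ 4 * R) (hφ' : |φ q'| ≤ 4 * R) :
    edist (patch φ R q) (patch φ R q') ≤ ENNReal.ofReal (10 * R) := by
  obtain ⟨⟨h1, h2⟩, h3, h4⟩ := hq
  obtain ⟨⟨h1', h2'⟩, h3', h4'⟩ := hq'
  rw [edist_dist]
  refine ENNReal.ofReal_le_ofReal ?_
  rw [EuclideanSpace.dist_eq]
  refine Real.sqrt_le_iff.2 ⟨by positivity, ?_⟩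
  simp only [Fin.sum_univ_three, Real.dist_eq, sq_abs, patch, PiLp.toLp_apply, Matrix.cons_val_zero,
    Matrix.cons_val_one, Matrix.cons_val]
  rw [abs_le] at hφ hφ'
  have e1 : (φ q - φ q') ^ 2 ≤ (8 * R) ^ 2 := sq_le_sq' (by linarith) (by linarith)
  have e2 : (R * q.1 - R * q'.1) ^ 2 ≤ R ^ 2 := sq_le_sq' (by nlinarith) (by nlinarith)
  have e3 : (R * q.2 - R * q'.2) ^ 2 ≤ R ^ 2 := sq_le_sq' (by nlinarith) (by nlinarith)
  nlinarith [sq_nonneg R]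

/-! ### Superposition of patches. -/

theorem tsum_ofReal_half_pow : ∑' i : ℕ, ENNReal.ofReal ((1 / 2) ^ (i + 1)) = 1 := by
  rw [← ENNReal.ofReal_tsum_of_nonneg (fun i => by positivity)
    ((summable_nat_add_iff 1).2 summable_geometric_two)]
  simp_rw [pow_succ, tsum_mul_right, tsum_geometric_two]
  norm_num

/-- A measure of total mass one with Green energy at most one and infinite Newtonian energy exists
as soon as `D` contains graphs over small squares that approach the boundary of `D`. -/
theorem exists_measure_of_patches {D S : Set (EuclideanSpace ℝ (Fin 3))} (hD : MeasurableSet D)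
    (hS : MeasurableSet S) {img : EuclideanSpace ℝ (Fin 3) → EuclideanSpace ℝ (Fin 3)}
    (himg : Measurable img) {k : EuclideanSpace ℝ (Fin 3) → ℝ}
    (hSD : ∀ x ∈ S, IsImagePoint D x (img x) (k x))
    (hpatch : ∀ R, 0 < R → R ≤ 1 / 4 → ∀ δ, 0 < δ → ∃ φ : ℝ × ℝ → ℝ, Measurable φ ∧
      ∀ q ∈ Set.Icc (0 : ℝ) 1 ×ˢ Set.Icc (0 : ℝ) 1, patch φ R q ∈ S ∧
        dist (patch φ R q) (img (patch φ R q)) ≤ δ ∧ |φ q| ≤ 4 * R) :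
    ∃ μ : Measure D, μ Set.univ = 1 ∧ energy (greenKernel 2 D) μ ≤ 1 ∧
      energy (rieszKernel 2) (extend μ) = ⊤ := by
  set b : ℕ → ℝ := fun i => (1 / 2) ^ (i + 1) with hb
  have hb0 : ∀ i, 0 < b i := fun i => by positivity
  have hb1 : ∀ i, b i ≤ 1 := fun i => pow_le_one₀ (by norm_num) (by norm_num)
  have hbsum : ∑' i, ENNReal.ofReal (b i) = 1 := tsum_ofReal_half_pow
  set F : EuclideanSpace ℝ (Fin 3) × EuclideanSpace ℝ (Fin 3) → ℝ≥0∞ := fun p =>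
    edist p.1 (img p.1) ^ (1 / 2 : ℝ) * edist p.1 p.2 ^ (-(3 / 2) : ℝ) with hF
  have hFm : Measurable F := by fun_prop
  have hex : ∀ i, ∃ φ : ℝ × ℝ → ℝ, Measurable φ ∧
      (∀ q ∈ Set.Icc (0 : ℝ) 1 ×ˢ Set.Icc (0 : ℝ) 1,
        patch φ (b i ^ 2 / 4) q ∈ S ∧ |φ q| ≤ 4 * (b i ^ 2 / 4)) ∧
      ∀ y, ∫⁻ q, F (patch φ (b i ^ 2 / 4) q, y) ∂squareMeasure ≤ 1 := by
    intro i
    have hR : 0 < b i ^ 2 / 4 := by have := hb0 i; positivity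
    have hR' : b i ^ 2 / 4 ≤ 1 / 4 := by
      have := pow_le_one₀ (n := 2) (hb0 i).le (hb1 i)
      linarith
    -- `C` depends on the width alone, so the distance `δ = C⁻²` can be chosen before `φ`; then
    -- `δ^(1/2) * C = 1`.
    obtain ⟨C, hC, hCle⟩ := exists_lintegral_edist_patch_rpow_le hR
    obtain ⟨φ, hφ, hq⟩ := hpatch _ hR hR' ((C⁻¹) ^ 2) (by positivity)
    refine ⟨φ, hφ, fun q h => ⟨(hq q h).1, (hq q h).2.2⟩, fun y => ?_⟩
    have hpm := measurable_patch hφ (b i ^ 2 / 4)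
    calc ∫⁻ q, F (patch φ (b i ^ 2 / 4) q, y) ∂squareMeasure
        ≤ ∫⁻ q, ENNReal.ofReal C⁻¹ * edist (patch φ (b i ^ 2 / 4) q) y ^ (-(3 / 2) : ℝ)
            ∂squareMeasure := by
          refine lintegral_mono_ae ?_
          filter_upwards [ae_squareMeasure] with q h
          simp only [hF]
          gcongr
          calc edist (patch φ (b i ^ 2 / 4) q) (img (patch φ (b i ^ 2 / 4) q)) ^ (1 / 2 : ℝ)
              ≤ ENNReal.ofReal ((C⁻¹) ^ 2) ^ (1 / 2 : ℝ) := by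
                rw [edist_dist]
                gcongr
                exact (hq q h).2.1
            _ = ENNReal.ofReal C⁻¹ := by
                rw [ENNReal.ofReal_rpow_of_pos (by positivity), ← Real.sqrt_eq_rpow,
                  Real.sqrt_sq (by positivity)]
      _ = ENNReal.ofReal C⁻¹ * ∫⁻ q, edist (patch φ (b i ^ 2 / 4) q) y ^ (-(3 / 2) : ℝ)
            ∂squareMeasure := lintegral_const_mul _ (by fun_prop)
      _ ≤ ENNReal.ofReal C⁻¹ * ENNReal.ofReal C := by gcongr; exact hCle φ y
      _ = 1 := by
          rw [← ENNReal.ofReal_mul (by positivity), inv_mul_cancel₀ hC.ne', ENNReal.ofReal_one]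
  choose φ hφ hφS hφF using hex
  have hpm : ∀ i, Measurable (patch (φ i) (b i ^ 2 / 4)) := fun i => measurable_patch (hφ i) _
  set μ₀ : Measure (EuclideanSpace ℝ (Fin 3)) := Measure.sum fun i =>
    ENNReal.ofReal (b i) • squareMeasure.map (patch (φ i) (b i ^ 2 / 4)) with hμ₀
  have hlint : ∀ f : EuclideanSpace ℝ (Fin 3) → ℝ≥0∞, Measurable f → ∫⁻ x, f x ∂μ₀ =
      ∑' i, ENNReal.ofReal (b i) * ∫⁻ q, f (patch (φ i) (b i ^ 2 / 4) q) ∂squareMeasure := by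
    intro f hf
    rw [hμ₀, lintegral_sum_measure]
    refine tsum_congr fun i => ?_
    rw [lintegral_smul_measure, lintegral_map hf (hpm i), smul_eq_mul]
  have huniv : μ₀ Set.univ = 1 := by
    rw [← lintegral_one, hlint _ measurable_const]
    simpa using hbsum
  have hprob : IsProbabilityMeasure μ₀ := ⟨huniv⟩
  have hμS : ∀ᵐ x ∂μ₀, x ∈ S := by
    rw [hμ₀, Measure.ae_sum_iff]
    refine fun i => Measure.ae_smul_measure ?_ _
    rw [ae_map_iff (p := (· ∈ S)) (hpm i).aemeasurable hS]
    filter_upwards [ae_squareMeasure] with q hq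
    exact (hφS i q hq).1
  have hmap : (μ₀.comap (Subtype.val : D → EuclideanSpace ℝ (Fin 3))).map Subtype.val = μ₀ := by
    rw [(MeasurableEmbedding.subtype_coe hD).map_comap, Subtype.range_coe]
    exact Measure.restrict_eq_self_of_ae_mem (s := D) (hμS.mono fun x hx => (hSD x hx).mem)
  set μ : Measure D := μ₀.comap Subtype.val with hμ
  have hμuniv : μ Set.univ = 1 := by
    have h := Measure.map_apply (μ := μ) (measurable_subtype_coe (p := (· ∈ D))) MeasurableSet.univ
    rwa [hmap, huniv, Set.preimage_univ, eq_comm] at h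
  have hprobμ : IsProbabilityMeasure μ := ⟨hμuniv⟩
  have hμS' : ∀ᵐ x : D ∂μ, (x : EuclideanSpace ℝ (Fin 3)) ∈ S :=
    ae_of_ae_map measurable_subtype_coe.aemeasurable (by rwa [hmap])
  refine ⟨μ, hμuniv, ?_, ?_⟩
  · calc energy (greenKernel 2 D) μ
        ≤ ∫⁻ p, F ((p.1 : EuclideanSpace ℝ (Fin 3)), (p.2 : EuclideanSpace ℝ (Fin 3)))
            ∂(μ.prod μ) := by
          refine lintegral_mono_ae ?_
          have hfst : ∀ᵐ p ∂(μ.prod μ), (p.1 : EuclideanSpace ℝ (Fin 3)) ∈ S :=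
            Measure.quasiMeasurePreserving_fst.ae
              (p := fun x : D => (x : EuclideanSpace ℝ (Fin 3)) ∈ S) hμS'
          have hsnd : ∀ᵐ p ∂(μ.prod μ), (p.2 : EuclideanSpace ℝ (Fin 3)) ∈ S :=
            Measure.quasiMeasurePreserving_snd.ae
              (p := fun x : D => (x : EuclideanSpace ℝ (Fin 3)) ∈ S) hμS'
          filter_upwards [hfst, hsnd] with p h1 h2
          exact greenKernel_le hD (hSD _ h1) (hSD _ h2)
      -- The variable `x` is integrated first because the small factor `|x - x'|^(1/2)` belongs to
      -- it.
      _ = ∫⁻ y : D, ∫⁻ x : D, F ((x : EuclideanSpace ℝ (Fin 3)), (y : EuclideanSpace ℝ (Fin 3)))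
            ∂μ ∂μ := lintegral_prod_symm _ (by fun_prop)
      _ ≤ ∫⁻ _ : D, 1 ∂μ := by
          refine lintegral_mono fun y => ?_
          have h1 := lintegral_map (μ := μ) (f := fun x => F (x, (y : EuclideanSpace ℝ (Fin 3))))
            (by fun_prop) measurable_subtype_coe
          rw [← h1, hmap, hlint _ (by fun_prop), ← hbsum]
          refine ENNReal.tsum_le_tsum fun i => ?_
          exact mul_le_of_le_one_right' (hφF i y)
      _ = 1 := by simp
  -- Only the self-energy of each patch is kept: diameter at most `10 R` and `R = (b i)² / 4` give
  -- `(b i)² / (10 R) = 2/5`.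
  · rw [extend, hmap, energy_eq_lintegral_potential, hlint _ (measurable_potential _),
      ← top_le_iff, ← ENNReal.tsum_const_eq_top_of_ne_zero (α := ℕ) (c := ENNReal.ofReal (2 / 5))
        (by norm_num)]
    refine ENNReal.tsum_le_tsum fun i => ?_
    have hR : 0 < b i ^ 2 / 4 := by have := hb0 i; positivity
    have h1 : ∀ q ∈ Set.Icc (0 : ℝ) 1 ×ˢ Set.Icc (0 : ℝ) 1,
        ENNReal.ofReal (b i) * (ENNReal.ofReal (10 * (b i ^ 2 / 4)))⁻¹ ≤
          potential (rieszKernel 2) μ₀ (patch (φ i) (b i ^ 2 / 4) q) := by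
      intro q hq
      rw [potential_two, hlint _ (by fun_prop)]
      refine le_trans ?_ (ENNReal.le_tsum i)
      gcongr
      calc (ENNReal.ofReal (10 * (b i ^ 2 / 4)))⁻¹
          = ∫⁻ _, (ENNReal.ofReal (10 * (b i ^ 2 / 4)))⁻¹ ∂squareMeasure := by simp
        _ ≤ _ := by
            refine lintegral_mono_ae ?_
            filter_upwards [ae_squareMeasure] with q' hq'
            rw [ENNReal.inv_le_inv]
            exact edist_patch_le hR hq hq' (hφS i q hq).2 (hφS i q' hq').2
    calc ENNReal.ofReal (2 / 5)
        = ENNReal.ofReal (b i) *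
          (ENNReal.ofReal (b i) * (ENNReal.ofReal (10 * (b i ^ 2 / 4)))⁻¹) := by
          rw [← ENNReal.ofReal_inv_of_pos (by positivity), ← ENNReal.ofReal_mul (hb0 i).le,
            ← ENNReal.ofReal_mul (hb0 i).le]
          congr 1
          have := hb0 i
          field_simp
          norm_num
      _ = ENNReal.ofReal (b i) * ∫⁻ _, ENNReal.ofReal (b i) *
            (ENNReal.ofReal (10 * (b i ^ 2 / 4)))⁻¹ ∂squareMeasure := by simp
      _ ≤ _ := by
          refine mul_le_mul_right (lintegral_mono_ae ?_) _
          filter_upwards [ae_squareMeasure] with q hq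
          exact h1 q hq

/-! ### The half-space. -/

/-- The reflection of `ℝ³` in the plane `x₁ = 0`. -/
noncomputable def planeReflection (x : EuclideanSpace ℝ (Fin 3)) : EuclideanSpace ℝ (Fin 3) :=
  !₂[-x 0, x 1, x 2]

theorem measurable_planeReflection : Measurable planeReflection := by
  refine (WithLp.measurable_toLp 2 (Fin 3 → ℝ)).comp (measurable_pi_iff.2 fun i => ?_)
  fin_cases i <;> simp <;> fun_prop

theorem isOpen_halfSpace : IsOpen halfSpace :=
  isOpen_lt continuous_const (by fun_prop)

theorem dist_planeReflection_sq (a y : EuclideanSpace ℝ (Fin 3)) :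
    dist a (planeReflection y) ^ 2 = dist a y ^ 2 + 4 * (a 0 * y 0) := by
  rw [EuclideanSpace.dist_eq, EuclideanSpace.dist_eq, Real.sq_sqrt (by positivity),
    Real.sq_sqrt (by positivity)]
  simp only [Fin.sum_univ_three, Real.dist_eq, sq_abs, planeReflection, PiLp.toLp_apply,
    Matrix.cons_val_zero, Matrix.cons_val_one, Matrix.cons_val]
  ring

theorem isImagePoint_halfSpace {y : EuclideanSpace ℝ (Fin 3)} (hy : y ∈ halfSpace) :
    IsImagePoint halfSpace y (planeReflection y) 1 := by
  have hy0 : 0 < y 0 := hy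
  have key : ∀ a, a ∈ halfSpace ↔ 1 * dist a y < dist a (planeReflection y) := by
    intro a
    rw [one_mul, ← sq_lt_sq₀ dist_nonneg dist_nonneg, dist_planeReflection_sq,
      lt_add_iff_pos_right, mul_pos_iff_of_pos_left (by norm_num), mul_pos_iff_of_pos_right hy0]
    rfl
  refine ⟨fun h => ?_, le_rfl, key⟩
  have := (key y).1 hy
  rw [← h, dist_self, mul_zero] at this
  exact lt_irrefl _ this

theorem exists_measure_halfSpace : ∃ μ : Measure halfSpace, μ Set.univ = 1 ∧
    energy (greenKernel 2 halfSpace) μ ≤ 1 ∧ energy (rieszKernel 2) (extend μ) = ⊤ := by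
  refine exists_measure_of_patches isOpen_halfSpace.measurableSet isOpen_halfSpace.measurableSet
    measurable_planeReflection (k := fun _ => 1) (fun x hx => isImagePoint_halfSpace hx) ?_
  intro R hR _ δ hδ
  -- A flat patch at this height; the distance to its mirror image is twice the height.
  have hm : 0 < min (δ / 2) R := lt_min (by positivity) hR
  refine ⟨fun _ => min (δ / 2) R, measurable_const, fun q _ => ⟨hm, ?_, ?_⟩⟩
  · refine abs_le_of_sq_le_sq' ?_ hδ.le |>.2
    rw [dist_planeReflection_sq, dist_self]
    have h1 : patch (fun _ => min (δ / 2) R) R q 0 = min (δ / 2) R := rfl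
    rw [h1]
    nlinarith [min_le_left (δ / 2) R]
  · rw [abs_of_pos hm]
    linarith [min_le_right (δ / 2) R]

/-! ### The ball. -/

open EuclideanGeometry

/-- The centre `(1, 0, 0)` of the ball. -/
noncomputable def ballCenter : EuclideanSpace ℝ (Fin 3) := !₂[1, 0, 0]

theorem mem_unitBall {x : EuclideanSpace ℝ (Fin 3)} : x ∈ unitBall ↔ dist x ballCenter < 1 :=
  Metric.mem_ball

theorem dist_inversion_sq {F : Type*} [NormedAddCommGroup F] [InnerProductSpace ℝ F]
    {o y : F} (hy : y ≠ o) (a : F) :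
    dist a (inversion o 1 y) ^ 2 = (1 / dist y o * dist a y) ^ 2 +
      (1 - dist a o ^ 2) * ((1 / dist y o) ^ 2 - 1) := by
  have hd : 0 < ‖y - o‖ := norm_pos_iff.2 (sub_ne_zero.2 hy)
  have h1 : a - inversion o 1 y = (a - o) - (1 / ‖y - o‖) ^ 2 • (y - o) := by
    rw [inversion, dist_eq_norm, vsub_eq_sub, vadd_eq_add]; abel
  have h2 : a - y = (a - o) - (y - o) := by abel
  rw [dist_eq_norm, dist_eq_norm, dist_eq_norm, dist_eq_norm, h1, h2, mul_pow, norm_sub_sq_real (a - o),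
    norm_sub_sq_real (a - o), inner_smul_right, norm_smul, Real.norm_of_nonneg (by positivity)]
  field_simp
  ring

/-- In `dist_inversion_sq` the correction term is positive exactly when `|a - o| < 1`. The centre is
excluded because its image would be at infinity. -/
theorem isImagePoint_unitBall {y : EuclideanSpace ℝ (Fin 3)} (hy : y ∈ unitBall)
    (hyo : y ≠ ballCenter) :
    IsImagePoint unitBall y (inversion ballCenter 1 y) (1 / dist y ballCenter) := by
  rw [mem_unitBall] at hy
  have hd : 0 < dist y ballCenter := dist_pos.2 hyo
  have hinv : 1 < 1 / dist y ballCenter := (one_lt_div hd).2 hy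
  have key : ∀ a, a ∈ unitBall ↔
      1 / dist y ballCenter * dist a y < dist a (inversion ballCenter 1 y) := by
    intro a
    rw [← sq_lt_sq₀ (by positivity) dist_nonneg, dist_inversion_sq hyo, lt_add_iff_pos_right,
      mul_pos_iff_of_pos_right (by nlinarith), mem_unitBall, sub_pos,
      sq_lt_one_iff₀ dist_nonneg]
  refine ⟨fun h => ?_, hinv.le, key⟩
  have := (key y).1 (mem_unitBall.2 hy)
  rw [← h, dist_self, mul_zero] at this
  exact lt_irrefl _ this

theorem dist_inversion_self {F : Type*} [NormedAddCommGroup F] [InnerProductSpace ℝ F]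
    {o y : F} (hy : y ≠ o) (h1 : dist y o ≤ 1) :
    dist y (inversion o 1 y) = 1 / dist y o - dist y o := by
  have hd : 0 < dist y o := dist_pos.2 hy
  have h2 : 1 ≤ 1 / dist y o := (one_le_div hd).2 h1
  rw [← sq_eq_sq₀ dist_nonneg (by linarith), dist_inversion_sq hy, dist_self]
  field_simp
  ring

theorem exists_measure_unitBall : ∃ μ : Measure unitBall, μ Set.univ = 1 ∧
    energy (greenKernel 2 unitBall) μ ≤ 1 ∧ energy (rieszKernel 2) (extend μ) = ⊤ := by
  have hD : MeasurableSet unitBall := measurableSet_ball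
  have himg : Measurable (inversion ballCenter (1 : ℝ)) := by
    unfold inversion
    simp only [vsub_eq_sub, vadd_eq_add]
    fun_prop
  refine exists_measure_of_patches (S := unitBall \ {ballCenter}) hD
    (hD.diff (measurableSet_singleton _)) himg (k := fun y => 1 / dist y ballCenter)
    (fun x hx => isImagePoint_unitBall hx.1 hx.2) ?_
  intro R hR hR4 δ hδ
  -- The patch is cut from the concentric sphere of radius `1 - ε`, close to the origin. Its points
  -- are `1/(1-ε) - (1-ε) ≤ 4ε ≤ δ` away from their images, and `ε ≤ R/4` keeps the height below
  -- `R`.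
  set ε := min (δ / 4) (R / 4) with hε
  have hε0 : 0 < ε := lt_min (by positivity) (by positivity)
  have hεδ : ε ≤ δ / 4 := min_le_left _ _
  have hεR : ε ≤ R / 4 := min_le_right _ _
  refine ⟨fun q => 1 - √((1 - ε) ^ 2 - R ^ 2 * (q.1 ^ 2 + q.2 ^ 2)), by fun_prop, fun q hq => ?_⟩
  obtain ⟨⟨h1, h2⟩, h3, h4⟩ := hq
  have hq1 : q.1 ^ 2 ≤ 1 := pow_le_one₀ h1 h2
  have hq2 : q.2 ^ 2 ≤ 1 := pow_le_one₀ h3 h4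
  have hRR : R ^ 2 * (q.1 ^ 2 + q.2 ^ 2) ≤ R / 2 := by nlinarith [sq_nonneg R]
  have hRR0 : 0 ≤ R ^ 2 * (q.1 ^ 2 + q.2 ^ 2) := by positivity
  set Q := (1 - ε) ^ 2 - R ^ 2 * (q.1 ^ 2 + q.2 ^ 2) with hQ
  have hQ1 : Q ≤ 1 := by nlinarith
  have hQ2 : 1 - R ≤ Q := by nlinarith [sq_nonneg ε]
  have hQ0 : 0 ≤ Q := by linarith
  have hs1 : √Q ≤ 1 := Real.sqrt_le_one.2 hQ1
  have hs2 : Q ≤ √Q := Real.le_sqrt_of_sq_le (by nlinarith)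
  set x := patch (fun q => 1 - √((1 - ε) ^ 2 - R ^ 2 * (q.1 ^ 2 + q.2 ^ 2))) R q with hx
  have hdist : dist x ballCenter = 1 - ε := by
    rw [EuclideanSpace.dist_eq, ← Real.sqrt_sq (by linarith : 0 ≤ 1 - ε)]
    congr 1
    simp only [Fin.sum_univ_three, Real.dist_eq, sq_abs, hx, patch, ballCenter, PiLp.toLp_apply,
      Matrix.cons_val_zero, Matrix.cons_val_one, Matrix.cons_val]
    rw [← hQ]
    nlinarith [Real.sq_sqrt hQ0]
  have hxo : x ≠ ballCenter := dist_pos.1 (by rw [hdist]; linarith)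
  refine ⟨⟨mem_unitBall.2 (by rw [hdist]; linarith), hxo⟩, ?_, ?_⟩
  · rw [dist_inversion_self hxo (by rw [hdist]; linarith), hdist, sub_le_iff_le_add,
      div_le_iff₀ (by linarith)]
    nlinarith
  · rw [abs_of_nonneg (by linarith)]
    linarith

end RieszGreen

theorem mainTheorem10 :
    (∃ μ : MeasureTheory.Measure RieszGreen.halfSpace,
      μ Set.univ = 1 ∧
      RieszGreen.energy (RieszGreen.greenKernel 2 RieszGreen.halfSpace) μ ≤ 1 ∧
      RieszGreen.energy (RieszGreen.rieszKernel 2) (RieszGreen.extend μ) = ⊤) ∧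
    (∃ μ : MeasureTheory.Measure RieszGreen.unitBall,
      μ Set.univ < ⊤ ∧
      RieszGreen.energy (RieszGreen.greenKernel 2 RieszGreen.unitBall) μ ≤ 1 ∧
      RieszGreen.energy (RieszGreen.rieszKernel 2) (RieszGreen.extend μ) = ⊤) := by
  refine ⟨RieszGreen.exists_measure_halfSpace, ?_⟩
  obtain ⟨μ, h1, h2, h3⟩ := RieszGreen.exists_measure_unitBall
  exact ⟨μ, h1 ▸ ENNReal.one_lt_top, h2, h3⟩
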